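/- Let $n_T\ge 1$, let $\mathbf h\in\mathbb C^{n_T}$ be a fixed vector (the main channel, known at the transmitter), let $\mathbf g=(g_1,\dots,g_{n_T})\sim CN(0,\mathbf I_{n_T})$ be a random vector (the channel to the single-antenna eavesdropper, of which only the law is known), and let $P_T\ge 0$ be the total power. With $(x)^+=\max\{0,x\}$ and $\log$ the natural logarithm, let the ergodic secrecy rate with generalized artificial noise (AN) be $$R_{GAN}=\max_{(\mathbf S_u,\mathbf S_v)\in S}\left(\log\frac{1+\mathbf h^H(\mathbf S_u+\mathbf S_v)\mathbf h}{1+\mathbf h^H\mathbf S_v\mathbf h}-\mathbf E\left[\log\frac{1+\mathbf g^H(\mathbf S_u+\mathbf S_v)\mathbf g}{1+\mathbf g^H\mathbf S_v\mathbf g}\right]\right)^+,$$ where $S$ is the set of pairs of positive semidefinite matrices $\mathbf S_u,\mathbf S_v\in\mathbb C^{n_T\times n_T}$ (the covariance matrices of signal and AN) with $\mathrm{tr}(\mathbf S_u+\mathbf S_v)\le P_T$. Put $\tilde G_i=|g_i|^2$ for $i=1,\dots,n_T$. Then $\tilde G_1,\dots,\tilde G_{n_T}$ are independent and exponentially distributed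 with mean $1$, all the expectations above and below are finite, both maxima are attained, and $$R_{GAN}=\max_{\substack{P_U,\,P_{V_1},\,P_{V_2}\ge 0\\ P_U+P_{V_1}+(n_T-1)P_{V_2}=P_T}}\left(\log\left(1+\frac{\|\mathbf h\|^2P_U}{1+\|\mathbf h\|^2P_{V_1}}\right)-\mathbf E\left[\log\left(1+\frac{\tilde G_1P_U}{1+\tilde G_1P_{V_1}+\left(\sum_{i=2}^{n_T}\tilde G_i\right)P_{V_2}}\right)\right]\right)^+.$$ Here $P_U$, $P_{V_1}$ and $P_{V_2}$ are the powers of the signal (along $\mathbf h$), of the AN along $\mathbf h$, and of the AN in each direction orthogonal to $\mathbf h$: if $\mathbf h\ne 0$ then, for every feasible triple $(P_U,P_{V_1},P_{V_2})$, the matrices $\mathbf S_u=P_U\frac{\mathbf h\mathbf h^H}{\|\mathbf h\|^2}$ and $\mathbf S_v=P_{V_1}\frac{\mathbf h\mathbf h^H}{\|\mathbf h\|^2}+P_{V_2}\left(\mathbf I_{n_T}-\frac{\mathbf h\mathbf h^H}{\|\mathbf h\|^2}\right)$ form a pair in $S$, and the objective of the first problem at this pair equals the objective of the second problem at the triple.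 -/

import Mathlib

open MeasureTheory ProbabilityTheory Matrix
open scoped ComplexOrder

/-- The circularly symmetric complex normal law `CN(0, 1)` on `ℂ`: the real and imaginary parts
are independent real normal variables of mean `0` and variance `1/2`. -/
noncomputable def complexGaussian : Measure ℂ :=
  ((gaussianReal 0 (1 / 2)).prod (gaussianReal 0 (1 / 2))).map
    (fun p : ℝ × ℝ => (⟨p.1, p.2⟩ : ℂ))

/-- The law `CN(0, I_n)` on `ℂ^n`: the coordinates are independent and `CN(0, 1)`. -/
noncomputable def complexGaussianVec (n : ℕ) : Measure (Fin n → ℂ) :=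
  Measure.pi (fun _ => complexGaussian)

/-- The quadratic form `x^H S x` of a Hermitian matrix `S` (a real number). -/
noncomputable def quadForm {n : ℕ} (S : Matrix (Fin n) (Fin n) ℂ) (x : Fin n → ℂ) : ℝ :=
  (star x ⬝ᵥ (S *ᵥ x)).re

/-- Admissible pairs `(S_u, S_v)` of covariance matrices of signal and artificial noise under the
total power constraint `tr (S_u + S_v) ≤ P_T`. -/
def admissibleCov (n : ℕ) (PT : ℝ) : Set (Matrix (Fin n) (Fin n) ℂ × Matrix (Fin n) (Fin n) ℂ) :=
  {S | S.1.PosSemidef ∧ S.2.PosSemidef ∧ (S.1 + S.2).trace.re ≤ PT}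

/-- The quantity inside the eavesdropper's expectation, for the channel realization `x`. -/
noncomputable def eveTerm {n : ℕ} (Su Sv : Matrix (Fin n) (Fin n) ℂ) (x : Fin n → ℂ) : ℝ :=
  Real.log ((1 + quadForm (Su + Sv) x) / (1 + quadForm Sv x))

/-- The ergodic secrecy rate with generalized artificial noise of a pair `(S_u, S_v)`, for the main
channel `h` and the random eavesdropper channel `g`. -/
noncomputable def ganRate {n : ℕ} {Ω : Type*} [MeasurableSpace Ω] (μ : Measure Ω)
    (g : Ω → Fin n → ℂ) (h : EuclideanSpace ℂ (Fin n))
    (Su Sv : Matrix (Fin n) (Fin n) ℂ) : ℝ :=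
  max 0 (Real.log ((1 + quadForm (Su + Sv) h.ofLp) / (1 + quadForm Sv h.ofLp))
    - ∫ ω, eveTerm Su Sv (g ω) ∂μ)

/-- The power allocation among the signal, the artificial noise along the main channel, and the
artificial noise in each direction of its orthogonal complement. -/
structure PowerAllocation where
  /-- power of the signal -/
  PU : ℝ
  /-- power of the artificial noise along the main channel -/
  PV1 : ℝ
  /-- power of the artificial noise in each direction orthogonal to the main channel -/
  PV2 : ℝ

/-- Nonnegative powers that use up the whole budget: `P_U + P_V1 + (n - 1) P_V2 = P_T`. -/
def admissiblePowers (n : ℕ) (PT : ℝ) : Set PowerAllocation :=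
  {p | 0 ≤ p.PU ∧ 0 ≤ p.PV1 ∧ 0 ≤ p.PV2 ∧ p.PU + p.PV1 + ((n : ℝ) - 1) * p.PV2 = PT}

/-- The quantity inside the eavesdropper's expectation of the scalar problem, for the gains `G`
(the first gain is `G 0`, the remaining ones are `G i` with `i ≠ 0`). -/
noncomputable def eveTermScalar {n : ℕ} [NeZero n] (p : PowerAllocation) (G : Fin n → ℝ) : ℝ :=
  Real.log (1 + G 0 * p.PU /
    (1 + G 0 * p.PV1 + (∑ i ∈ Finset.univ.erase (0 : Fin n), G i) * p.PV2))

/-- The objective function of the scalar power allocation problem, for random gains `G`. -/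
noncomputable def scalarRate {n : ℕ} [NeZero n] {Ω : Type*} [MeasurableSpace Ω] (μ : Measure Ω)
    (G : Ω → Fin n → ℝ) (h : EuclideanSpace ℂ (Fin n)) (p : PowerAllocation) : ℝ :=
  max 0 (Real.log (1 + ‖h‖ ^ 2 * p.PU / (1 + ‖h‖ ^ 2 * p.PV1))
    - ∫ ω, eveTermScalar p (G ω) ∂μ)

/-- The orthogonal projection `h h^H / ‖h‖²` onto the line spanned by `h`. -/
noncomputable def projLine {n : ℕ} (h : EuclideanSpace ℂ (Fin n)) : Matrix (Fin n) (Fin n) ℂ :=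
  (((‖h‖ ^ 2)⁻¹ : ℝ) : ℂ) • vecMulVec h.ofLp (star h.ofLp)

/-- The signal covariance of a power allocation: beamforming along `h` with power `P_U`. -/
noncomputable def signalCov {n : ℕ} (h : EuclideanSpace ℂ (Fin n)) (p : PowerAllocation) :
    Matrix (Fin n) (Fin n) ℂ :=
  (p.PU : ℂ) • projLine h

/-- The artificial-noise covariance of a power allocation: power `P_V1` along `h`, and power `P_V2`
in each direction orthogonal to `h`. -/
noncomputable def noiseCov {n : ℕ} (h : EuclideanSpace ℂ (Fin n)) (p : PowerAllocation) :
    Matrix (Fin n) (Fin n) ℂ :=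
  (p.PV1 : ℂ) • projLine h + (p.PV2 : ℂ) • (1 - projLine h)

/-! The law CN(0, I) is unitarily invariant, so `h` may be rotated onto the first axis. The
main-channel term then sees only the corner entries `a` of S_u and `v` of S_v, and what remains is a
lower bound for the eavesdropper's expectation given these entries and the trace.

That bound (`integral_eveTermScalar_le`) comes from one tangent inequality. Put T = 1 + x^H (S_u +
S_v) x and u = (S_u x)_0 / √a. Cauchy-Schwarz gives |u|² ≤ x^H S_u x, so the eavesdropper's term is
at least -log(1 - |u|²/T), which is jointly convex in (u, T). Its tangent is taken at the values of
u and T belonging to the candidate pair: signal `a` on the first axis, noise diag(v, b, ..., b). The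
first-order term in u is odd under x_0 ↦ -x_0 and integrates to zero. The first-order term in T is a
quadratic form with a weight that depends only on the |x_i|² and is symmetric in i ≠ 0; its integral
sees only the sum of the off-corner diagonal entries, whose sign is fixed by the trace bound.

The budget must be used up exactly. For n ≥ 2 the unused power becomes noise orthogonal to `h`,
through the choice of `b`. For n = 1 there is no such direction, and it goes to the signal
(`scalarRate_le_of_erase_empty`). The scalar maximum exists by compactness and is carried back to
matrices by the equality of the two objectives along `signalCov`, `noiseCov`. For h = 0 both rates
vanish. -/

/-! ### The complex normal law and its unitary invariance -/

theorem measurable_complex_mk : Measurable (fun p : ℝ × ℝ => (⟨p.1, p.2⟩ : ℂ)) :=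
  Complex.measurableEquivRealProd.symm.measurable

instance isProbabilityMeasure_complexGaussian : IsProbabilityMeasure complexGaussian :=
  Measure.isProbabilityMeasure_map measurable_complex_mk.aemeasurable

instance isProbabilityMeasure_complexGaussianVec (n : ℕ) :
    IsProbabilityMeasure (complexGaussianVec n) := by
  unfold complexGaussianVec; infer_instance

theorem charFun_complexGaussian (t : ℂ) :
    charFun complexGaussian t = Complex.exp (-(‖t‖ ^ 2 : ℝ) / 4) := by
  rw [charFun_apply, complexGaussian, integral_map measurable_complex_mk.aemeasurable
    (Measurable.aestronglyMeasurable (by fun_prop))]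
  have h1 : ∀ p : ℝ × ℝ, Complex.exp ((inner ℝ (⟨p.1, p.2⟩ : ℂ) t : ℝ) * Complex.I) =
      Complex.exp (t.re * p.1 * Complex.I) * Complex.exp (t.im * p.2 * Complex.I) := by
    intro p
    rw [← Complex.exp_add, Complex.inner]
    congr 1
    simp
    ring
  simp_rw [h1]
  rw [integral_prod_mul (fun x : ℝ => Complex.exp (t.re * x * Complex.I))
    (fun x : ℝ => Complex.exp (t.im * x * Complex.I)), ← charFun_apply_real, ← charFun_apply_real,
    charFun_gaussianReal, charFun_gaussianReal, ← Complex.exp_add, ← Complex.normSq_eq_norm_sq,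
    Complex.normSq_apply]
  congr 1
  push_cast
  simp
  ring

theorem charFun_complexGaussianVec (n : ℕ) (t : EuclideanSpace ℂ (Fin n)) :
    charFun ((complexGaussianVec n).map (WithLp.toLp 2)) t =
      Complex.exp (-(‖t‖ ^ 2 : ℝ) / 4) := by
  rw [complexGaussianVec, charFun_pi]
  simp_rw [charFun_complexGaussian]
  rw [← Complex.exp_sum, EuclideanSpace.norm_sq_eq]
  congr 1
  push_cast
  rw [← Finset.sum_div, Finset.sum_neg_distrib]

theorem norm_toLp_mulVec {n : ℕ} {U : Matrix (Fin n) (Fin n) ℂ} (hU : Uᴴ * U = 1)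
    (x : Fin n → ℂ) : ‖WithLp.toLp 2 (U *ᵥ x)‖ = ‖WithLp.toLp 2 x‖ := by
  have key : ∀ y : Fin n → ℂ, ((‖WithLp.toLp 2 y‖ ^ 2 : ℝ) : ℂ) = star y ⬝ᵥ y := by
    intro y
    rw [EuclideanSpace.norm_sq_eq]
    push_cast
    simp only [dotProduct, Pi.star_apply, RCLike.star_def]
    exact Finset.sum_congr rfl fun i _ => (Complex.conj_mul' _).symm
  have h2 : ‖WithLp.toLp 2 (U *ᵥ x)‖ ^ 2 = ‖WithLp.toLp 2 x‖ ^ 2 := by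
    apply Complex.ofReal_injective
    rw [key, key, star_mulVec, ← dotProduct_mulVec, mulVec_mulVec, hU, one_mulVec]
  exact (sq_eq_sq₀ (norm_nonneg _) (norm_nonneg _)).1 h2

/-- The characteristic function exp(-‖t‖²/4) depends on `t` only through its norm, and a unitary map
is an isometry of the underlying real Euclidean space; measures with equal characteristic functions
coincide. -/
theorem measurePreserving_mulVec {n : ℕ} {U : Matrix (Fin n) (Fin n) ℂ} (hU : Uᴴ * U = 1) :
    MeasurePreserving (fun x => U *ᵥ x) (complexGaussianVec n) (complexGaussianVec n) := by
  have hU' : U * Uᴴ = 1 := mul_eq_one_comm.1 hU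
  have hm : Measurable (fun x : Fin n → ℂ => U *ᵥ x) := by
    have : Continuous (fun x : Fin n → ℂ => U *ᵥ x) := by fun_prop
    exact this.measurable
  refine ⟨hm, ?_⟩
  have hT : Measurable (WithLp.toLp 2 : (Fin n → ℂ) → EuclideanSpace ℂ (Fin n)) := by fun_prop
  let f : EuclideanSpace ℂ (Fin n) ≃ₗᵢ[ℝ] EuclideanSpace ℂ (Fin n) :=
    { toFun := fun x => WithLp.toLp 2 (U *ᵥ x.ofLp)
      invFun := fun x => WithLp.toLp 2 (Uᴴ *ᵥ x.ofLp)
      map_add' := fun x y => by simp [mulVec_add]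
      map_smul' := fun c x => by simp [mulVec_smul]
      left_inv := fun x => by simp [hU]
      right_inv := fun x => by simp [hU']
      norm_map' := fun x => norm_toLp_mulVec hU _ }
  have hf : (((complexGaussianVec n).map (WithLp.toLp 2)).map f) =
      (complexGaussianVec n).map (WithLp.toLp 2) := by
    have : IsProbabilityMeasure ((complexGaussianVec n).map
        (WithLp.toLp 2 : (Fin n → ℂ) → EuclideanSpace ℂ (Fin n))) :=
      Measure.isProbabilityMeasure_map hT.aemeasurable
    have : IsProbabilityMeasure (((complexGaussianVec n).map
        (WithLp.toLp 2 : (Fin n → ℂ) → EuclideanSpace ℂ (Fin n))).map f) :=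
      Measure.isProbabilityMeasure_map f.continuous.measurable.aemeasurable
    refine Measure.ext_of_charFun (funext fun t => ?_)
    have h1 : charFun (((complexGaussianVec n).map (WithLp.toLp 2)).map f) t =
        charFun ((complexGaussianVec n).map (WithLp.toLp 2)) (f.symm t) := by
      rw [charFun_apply, charFun_apply, integral_map f.continuous.measurable.aemeasurable
        (Measurable.aestronglyMeasurable (by fun_prop))]
      simp_rw [← f.inner_map_map _ (f.symm t), f.apply_symm_apply]
    rw [h1, charFun_complexGaussianVec, charFun_complexGaussianVec, f.symm.norm_map]
  have h2 := congrArg (Measure.map (WithLp.ofLp : EuclideanSpace ℂ (Fin n) → Fin n → ℂ)) hf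
  have hO : Measurable (WithLp.ofLp : EuclideanSpace ℂ (Fin n) → Fin n → ℂ) := by fun_prop
  have hfm : Measurable f := f.continuous.measurable
  rw [Measure.map_map hO hfm, Measure.map_map (hO.comp hfm) hT, Measure.map_map hO hT] at h2
  exact h2.trans Measure.map_id

/-! ### The squared moduli: integrability, exponential law, independence -/

theorem integrable_norm_sq_complexGaussian :
    Integrable (fun z : ℂ => ‖z‖ ^ 2) complexGaussian := by
  rw [complexGaussian, integrable_map_measure (Measurable.aestronglyMeasurable (by fun_prop))
    measurable_complex_mk.aemeasurable]
  have h : (fun z : ℂ => ‖z‖ ^ 2) ∘ (fun p : ℝ × ℝ => (⟨p.1, p.2⟩ : ℂ)) =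
      fun p => p.1 ^ 2 + p.2 ^ 2 := by
    funext p
    simp only [Function.comp, ← Complex.normSq_eq_norm_sq, Complex.normSq_apply]
    ring
  rw [h]
  have h2 : Integrable (fun x : ℝ => x ^ 2) (gaussianReal 0 (1 / 2)) :=
    (memLp_id_gaussianReal 2).integrable_sq
  exact (h2.comp_fst _).add (h2.comp_snd _)

theorem measurePreserving_eval_complexGaussianVec {n : ℕ} (i : Fin n) :
    MeasurePreserving (Function.eval i) (complexGaussianVec n) complexGaussian :=
  measurePreserving_eval (fun _ : Fin n => complexGaussian) i

theorem integrable_norm_sq_apply {n : ℕ} (i : Fin n) :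
    Integrable (fun x : Fin n → ℂ => ‖x i‖ ^ 2) (complexGaussianVec n) :=
  (measurePreserving_eval_complexGaussianVec i).integrable_comp_of_integrable
    integrable_norm_sq_complexGaussian

/-- The planar density is exp(-r²)/π. In polar coordinates the angle contributes 2π, and the
substitution t = r², dt = 2r dr, turns the radial integral into that of exp(-t). -/
theorem map_complexGaussian_norm_sq :
    complexGaussian.map (fun z => ‖z‖ ^ 2) = expMeasure 1 := by
  have hm : Measurable (fun z : ℂ => ‖z‖ ^ 2) := by fun_prop
  ext s hs
  have hexp : expMeasure 1 s = ∫⁻ t in Set.Ioi (0 : ℝ),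
      ENNReal.ofReal (Real.exp (-t)) * s.indicator 1 t := by
    have h0 : expMeasure 1 = volume.withDensity (exponentialPDF 1) := rfl
    rw [h0, withDensity_apply _ hs, ← lintegral_indicator hs,
      ← lintegral_indicator measurableSet_Ioi]
    -- The exponential density is nonzero at 0, a point excluded from `Set.Ioi 0`; the difference is
    -- a null set.
    have hae : ∀ᵐ t : ℝ, t ≠ 0 := by simp [ae_iff, measure_singleton]
    refine lintegral_congr_ae ?_
    filter_upwards [hae] with t ht
    by_cases h1 : t ∈ s
    · rcases lt_or_gt_of_ne ht with h2 | h2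
      · simp [h1, exponentialPDF_of_neg h2, not_lt.2 h2.le]
      · simp [h1, exponentialPDF_of_nonneg h2.le, h2]
    · simp [h1, Set.indicator]
  have hpdf : ∀ x : ℝ, gaussianPDF 0 (1 / 2) x =
      ENNReal.ofReal ((√Real.pi)⁻¹ * Real.exp (-x ^ 2)) := by
    intro x
    rw [gaussianPDF, gaussianPDFReal]
    congr 3
    · simp
      field_simp
    · simp
  have hm2 : Measurable (fun p : ℝ × ℝ => s.indicator (1 : ℝ → ENNReal) (p.1 ^ 2 + p.2 ^ 2)) :=
    (measurable_one.indicator hs).comp (by fun_prop)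
  rw [Measure.map_apply hm hs, complexGaussian, Measure.map_apply measurable_complex_mk (hm hs),
    ← lintegral_indicator_one (measurable_complex_mk (hm hs)),
    gaussianReal_of_var_ne_zero _ (by norm_num),
    prod_withDensity (measurable_gaussianPDF _ _) (measurable_gaussianPDF _ _),
    lintegral_withDensity_eq_lintegral_mul _ (by fun_prop)
      (measurable_one.indicator (measurable_complex_mk (hm hs))), hexp]
  refine (lintegral_congr (g := fun p : ℝ × ℝ =>
      ENNReal.ofReal (Real.pi⁻¹ * Real.exp (-(p.1 ^ 2 + p.2 ^ 2))) *
        s.indicator 1 (p.1 ^ 2 + p.2 ^ 2)) ?_).trans ?_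
  · intro p
    rw [Pi.mul_apply, hpdf, hpdf, ← ENNReal.ofReal_mul (by positivity)]
    congr 1
    · congr 1
      rw [neg_add, Real.exp_add]
      have : Real.pi⁻¹ = (√Real.pi)⁻¹ * (√Real.pi)⁻¹ := by
        rw [← mul_inv, Real.mul_self_sqrt Real.pi_pos.le]
      rw [this]; ring
    · have h2 : ‖(⟨p.1, p.2⟩ : ℂ)‖ ^ 2 = p.1 ^ 2 + p.2 ^ 2 := by
        rw [← Complex.normSq_eq_norm_sq, Complex.normSq_apply]; ring
      rw [← h2]; rfl
  rw [← Measure.volume_eq_prod]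
  rw [← lintegral_comp_polarCoord_symm, polarCoord_target, Measure.volume_eq_prod,
    setLIntegral_prod _ (by
      apply Measurable.aemeasurable
      simp only [polarCoord_symm_apply, smul_eq_mul]
      refine Measurable.mul (by fun_prop) (Measurable.mul (by fun_prop) ?_)
      exact hm2.comp (g := fun p : ℝ × ℝ => s.indicator (1 : ℝ → ENNReal) (p.1 ^ 2 + p.2 ^ 2))
        (f := fun p : ℝ × ℝ => (p.1 * Real.cos p.2, p.1 * Real.sin p.2)) (by fun_prop))]
  have hsq : (fun r : ℝ => r ^ 2) '' Set.Ioi 0 = Set.Ioi 0 := by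
    ext t
    constructor
    · rintro ⟨r, hr, rfl⟩
      exact pow_pos (Set.mem_Ioi.1 hr) 2
    · intro ht
      exact ⟨√t, Real.sqrt_pos.2 ht, Real.sq_sqrt (le_of_lt ht)⟩
  have hsub := lintegral_image_eq_lintegral_abs_deriv_mul measurableSet_Ioi
    (f' := fun r => 2 * r) (fun r _ => by simpa using (hasDerivAt_pow 2 r).hasDerivWithinAt)
    (fun a ha b hb hab => (sq_eq_sq₀ (Set.mem_Ioi.1 ha).le (Set.mem_Ioi.1 hb).le).1 hab)
    (fun t => ENNReal.ofReal (Real.exp (-t)) * s.indicator 1 t)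
  rw [hsq] at hsub
  rw [hsub]
  refine setLIntegral_congr_fun measurableSet_Ioi fun r hr => ?_
  have hr' : (0 : ℝ) < r := hr
  simp only [polarCoord_symm_apply]
  have h3 : ∀ θ : ℝ, (r * Real.cos θ) ^ 2 + (r * Real.sin θ) ^ 2 = r ^ 2 := by
    intro θ
    rw [mul_pow, mul_pow, ← mul_add, Real.cos_sq_add_sin_sq, mul_one]
  simp_rw [h3]
  rw [setLIntegral_const, Real.volume_Ioo, smul_eq_mul, ← mul_assoc, mul_right_comm, ← mul_assoc]
  congr 1
  rw [← ENNReal.ofReal_mul hr'.le, ← ENNReal.ofReal_mul (by positivity),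
    ← ENNReal.ofReal_mul (by positivity), abs_of_pos (by positivity)]
  congr 1
  field_simp
  ring

theorem hasLaw_norm_sq_apply {n : ℕ} (i : Fin n) :
    HasLaw (fun x : Fin n → ℂ => ‖x i‖ ^ 2) (expMeasure 1) (complexGaussianVec n) := by
  have h1 : HasLaw (fun z : ℂ => ‖z‖ ^ 2) (expMeasure 1) complexGaussian :=
    ⟨by fun_prop, map_complexGaussian_norm_sq⟩
  exact h1.comp (measurePreserving_eval_complexGaussianVec i).hasLaw

theorem iIndepFun_norm_sq_of_hasLaw {n : ℕ} {Ω : Type*} [MeasurableSpace Ω] {μ : Measure Ω}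
    [IsProbabilityMeasure μ] {g : Ω → Fin n → ℂ} (hg : HasLaw g (complexGaussianVec n) μ) :
    iIndepFun (fun i ω => ‖g ω i‖ ^ 2) μ := by
  have h1 : iIndepFun (fun i ω => g ω i) μ := by
    rw [iIndepFun_iff_map_fun_eq_pi_map (fun i => by
      exact (measurable_pi_apply i).comp_aemeasurable hg.aemeasurable)]
    refine hg.map_eq.trans ?_
    unfold complexGaussianVec
    congr 1
    funext i
    exact ((measurePreserving_eval_complexGaussianVec i).hasLaw.comp hg).map_eq.symm
  exact h1.comp (fun _ z => ‖z‖ ^ 2) (fun _ => by fun_prop)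

/-! ### Quadratic forms and the eavesdropper's term -/

section QuadForm

variable {n : ℕ}

theorem quadForm_add (S T : Matrix (Fin n) (Fin n) ℂ) (x : Fin n → ℂ) :
    quadForm (S + T) x = quadForm S x + quadForm T x := by
  simp [quadForm, add_mulVec, dotProduct_add]

theorem quadForm_eq_sum (S : Matrix (Fin n) (Fin n) ℂ) (x : Fin n → ℂ) :
    quadForm S x = ∑ i, ∑ j, (star (x i) * S i j * x j).re := by
  simp only [quadForm, dotProduct, mulVec, Finset.mul_sum, Complex.re_sum, Pi.star_apply, mul_assoc]

theorem quadForm_nonneg {S : Matrix (Fin n) (Fin n) ℂ} (hS : S.PosSemidef) (x : Fin n → ℂ) :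
    0 ≤ quadForm S x :=
  hS.re_dotProduct_nonneg x

theorem quadForm_mulVec (U S : Matrix (Fin n) (Fin n) ℂ) (x : Fin n → ℂ) :
    quadForm S (U *ᵥ x) = quadForm (Uᴴ * S * U) x := by
  simp only [quadForm, star_mulVec, dotProduct_mulVec, vecMul_vecMul, Matrix.mul_assoc]

theorem quadForm_smul_single (S : Matrix (Fin n) (Fin n) ℂ) (i : Fin n) (c : ℝ) :
    quadForm S (Pi.single i (c : ℂ)) = c ^ 2 * (S i i).re := by
  rw [quadForm_eq_sum, Finset.sum_eq_single i, Finset.sum_eq_single i]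
  · simp; ring
  · intro j _ hj; simp [hj]
  · simp
  · intro j _ hj; simp [hj]
  · simp

-- Cauchy-Schwarz for the semi-inner product defined by S: with S = Bᴴ B, the entry (S x)_i is the
-- inner product of B e_i and B x.
open scoped MatrixOrder Matrix.Norms.L2Operator in
theorem norm_mulVec_apply_sq_le {S : Matrix (Fin n) (Fin n) ℂ} (hS : S.PosSemidef)
    (i : Fin n) (x : Fin n → ℂ) :
    ‖(S *ᵥ x) i‖ ^ 2 ≤ (S i i).re * quadForm S x := by
  obtain ⟨B, rfl⟩ := CStarAlgebra.nonneg_iff_eq_star_mul_self.mp hS.nonneg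
  rw [star_eq_conjTranspose]
  have hq : ∀ y : Fin n → ℂ, quadForm (Bᴴ * B) y = ‖WithLp.toLp 2 (B *ᵥ y)‖ ^ 2 := by
    intro y
    rw [EuclideanSpace.norm_sq_eq, quadForm, ← mulVec_mulVec, dotProduct_mulVec, ← star_mulVec]
    simp only [dotProduct, Complex.re_sum, Pi.star_apply, RCLike.star_def, Complex.conj_mul',
      ← Complex.ofReal_pow, Complex.ofReal_re]
  have h1 : ((Bᴴ * B) *ᵥ x) i =
      inner ℂ (WithLp.toLp 2 (B *ᵥ Pi.single i 1)) (WithLp.toLp 2 (B *ᵥ x)) := by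
    rw [EuclideanSpace.inner_toLp_toLp, dotProduct_comm, star_mulVec, ← dotProduct_mulVec,
      mulVec_mulVec]
    simp
  have h2 : ((Bᴴ * B) i i).re = ‖WithLp.toLp 2 (B *ᵥ Pi.single i 1)‖ ^ 2 := by
    rw [← hq]
    have := quadForm_smul_single (Bᴴ * B) i 1
    simpa using this.symm
  rw [h1, h2, hq, ← mul_pow]
  exact pow_le_pow_left₀ (norm_nonneg _) (norm_inner_le_norm _ _) 2

theorem continuous_quadForm (S : Matrix (Fin n) (Fin n) ℂ) : Continuous (quadForm S) := by
  unfold quadForm; fun_prop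

theorem measurable_eveTerm (Su Sv : Matrix (Fin n) (Fin n) ℂ) : Measurable (eveTerm Su Sv) := by
  have h1 := (continuous_quadForm (Su + Sv)).measurable
  have h2 := (continuous_quadForm Sv).measurable
  exact Real.measurable_log.comp ((h1.const_add 1).div (h2.const_add 1))

theorem eveTerm_nonneg {Su Sv : Matrix (Fin n) (Fin n) ℂ} (hu : Su.PosSemidef)
    (hv : Sv.PosSemidef) (x : Fin n → ℂ) : 0 ≤ eveTerm Su Sv x := by
  have h1 := quadForm_nonneg hu x
  have h2 := quadForm_nonneg hv x
  refine Real.log_nonneg ?_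
  rw [quadForm_add, one_le_div (by linarith)]
  linarith

/-- From log y ≤ y - 1 and a denominator at least 1. This is the integrable majorant of the
eavesdropper's term. -/
theorem eveTerm_le {Su Sv : Matrix (Fin n) (Fin n) ℂ} (hu : Su.PosSemidef)
    (hv : Sv.PosSemidef) (x : Fin n → ℂ) : eveTerm Su Sv x ≤ quadForm Su x := by
  have h1 := quadForm_nonneg hu x
  have h2 := quadForm_nonneg hv x
  unfold eveTerm
  rw [quadForm_add]
  refine (Real.log_le_sub_one_of_pos (by positivity)).trans ?_
  rw [sub_le_iff_le_add, div_le_iff₀ (by linarith)]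
  nlinarith

end QuadForm

/-! ### Symmetries of Gaussian integrals -/

section Invariance

variable {n : ℕ}

theorem integral_mulVec {U : Matrix (Fin n) (Fin n) ℂ} (hU : Uᴴ * U = 1) (f : (Fin n → ℂ) → ℝ) :
    ∫ x, f (U *ᵥ x) ∂complexGaussianVec n = ∫ x, f x ∂complexGaussianVec n := by
  refine (measurePreserving_mulVec hU).integral_comp ?_ f
  have hc : Continuous (fun x : Fin n → ℂ => U *ᵥ x) := by fun_prop
  -- With a measurable embedding the change of variables holds for every `f`, so no measurability of
  -- `f` is asked for.
  refine hc.measurableEmbedding fun x y hxy => ?_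
  have := congrArg (fun z => Uᴴ *ᵥ z) hxy
  simpa [hU] using this

/-- The sign change of one coordinate is a diagonal unitary matrix, so the integral equals its own
negative. -/
theorem integral_eq_zero_of_flip (i : Fin n) {f : (Fin n → ℂ) → ℝ}
    (hf : ∀ x, f (Function.update x i (-x i)) = -f x) :
    ∫ x, f x ∂complexGaussianVec n = 0 := by
  have hU : (diagonal (Function.update (1 : Fin n → ℂ) i (-1)))ᴴ *
      diagonal (Function.update (1 : Fin n → ℂ) i (-1)) = 1 := by
    rw [diagonal_conjTranspose, diagonal_mul_diagonal, ← diagonal_one]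
    congr 1
    funext j
    by_cases hj : j = i
    · subst hj; simp
    · simp [hj]
  have h1 := integral_mulVec hU f
  have h2 : ∀ x : Fin n → ℂ, diagonal (Function.update (1 : Fin n → ℂ) i (-1)) *ᵥ x =
      Function.update x i (-x i) := by
    intro x
    funext j
    rw [mulVec_diagonal]
    by_cases hj : j = i
    · subst hj; simp
    · simp [hj]
  simp_rw [h2, hf, integral_neg] at h1
  linarith

theorem integral_comp_perm (σ : Equiv.Perm (Fin n)) (f : (Fin n → ℂ) → ℝ) :
    ∫ x, f (x ∘ σ) ∂complexGaussianVec n = ∫ x, f x ∂complexGaussianVec n := by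
  have hU : (σ.permMatrix ℂ)ᴴ * σ.permMatrix ℂ = 1 := by
    rw [conjTranspose_permMatrix, ← permMatrix_mul]
    simp
  rw [← integral_mulVec hU f]
  simp_rw [permMatrix_mulVec]

theorem integrable_weighted_entry {k : (Fin n → ℂ) → ℝ} (hk : Measurable k)
    (h0 : ∀ x, 0 ≤ k x) (h1 : ∀ x, k x ≤ 1) (c : ℂ) (i j : Fin n) :
    Integrable (fun x => k x * (star (x i) * c * x j).re) (complexGaussianVec n) := by
  refine (((integrable_norm_sq_apply i).add (integrable_norm_sq_apply j)).const_mul ‖c‖).mono'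
    (Measurable.aestronglyMeasurable (by fun_prop)) (Filter.Eventually.of_forall fun x => ?_)
  rw [norm_mul, Real.norm_of_nonneg (h0 x)]
  have h2 : ‖(star (x i) * c * x j).re‖ ≤ ‖x i‖ * ‖c‖ * ‖x j‖ := by
    refine (Complex.abs_re_le_norm _).trans ?_
    simp
  have h3 : 0 ≤ ‖c‖ := norm_nonneg c
  have h4 : k x * ‖(star (x i) * c * x j).re‖ ≤ 1 * (‖x i‖ * ‖c‖ * ‖x j‖) := by
    gcongr; exact h1 x
  refine h4.trans ?_
  simp only [Pi.add_apply]
  nlinarith [mul_nonneg h3 (add_nonneg (sq_nonneg (‖x i‖ - ‖x j‖))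
    (add_nonneg (sq_nonneg ‖x i‖) (sq_nonneg ‖x j‖)))]

theorem integrable_weighted_quadForm {k : (Fin n → ℂ) → ℝ} (hk : Measurable k)
    (h0 : ∀ x, 0 ≤ k x) (h1 : ∀ x, k x ≤ 1) (S : Matrix (Fin n) (Fin n) ℂ) :
    Integrable (fun x => k x * quadForm S x) (complexGaussianVec n) := by
  simp_rw [quadForm_eq_sum, Finset.mul_sum]
  exact integrable_finsetSum _ fun i _ => integrable_finsetSum _ fun j _ =>
    integrable_weighted_entry hk h0 h1 _ i j

theorem integrable_quadForm (S : Matrix (Fin n) (Fin n) ℂ) :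
    Integrable (quadForm S) (complexGaussianVec n) := by
  have := integrable_weighted_quadForm (n := n) (k := fun _ => 1) measurable_const
    (fun _ => zero_le_one) (fun _ => le_rfl) S
  simpa using this

theorem integrable_eveTerm {Su Sv : Matrix (Fin n) (Fin n) ℂ} (hu : Su.PosSemidef)
    (hv : Sv.PosSemidef) : Integrable (eveTerm Su Sv) (complexGaussianVec n) := by
  refine (integrable_quadForm Su).mono' (measurable_eveTerm _ _).aestronglyMeasurable
    (Filter.Eventually.of_forall fun x => ?_)
  rw [Real.norm_of_nonneg (eveTerm_nonneg hu hv x)]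
  exact eveTerm_le hu hv x

/-- A weight depending only on the squared moduli of the coordinates sees only the diagonal of a
quadratic form. -/
theorem integral_weighted_quadForm {k : (Fin n → ℂ) → ℝ} (hk : Measurable k)
    (h0 : ∀ x, 0 ≤ k x) (h1 : ∀ x, k x ≤ 1)
    (hflip : ∀ x i, k (Function.update x i (-x i)) = k x) (S : Matrix (Fin n) (Fin n) ℂ) :
    ∫ x, k x * quadForm S x ∂complexGaussianVec n =
      ∑ i, (S i i).re * ∫ x, k x * ‖x i‖ ^ 2 ∂complexGaussianVec n := by
  simp_rw [quadForm_eq_sum, Finset.mul_sum]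
  refine (integral_finsetSum
    (f := fun i x => ∑ j, k x * (star (x i) * S i j * x j).re) _ fun i _ =>
      integrable_finsetSum _ fun j _ => integrable_weighted_entry hk h0 h1 _ i j).trans ?_
  refine Finset.sum_congr rfl fun i _ => ?_
  refine (integral_finsetSum (f := fun j x => k x * (star (x i) * S i j * x j).re) _ fun j _ =>
    integrable_weighted_entry hk h0 h1 _ i j).trans ?_
  rw [Finset.sum_eq_single i]
  · rw [← integral_const_mul]
    refine integral_congr_ae (Filter.Eventually.of_forall fun x => ?_)
    have : star (x i) * S i i * x i = ((‖x i‖ ^ 2 : ℝ) : ℂ) * S i i := by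
      push_cast
      rw [← Complex.conj_mul', RCLike.star_def]
      ring
    simp only [this, Complex.re_ofReal_mul]
    ring
  -- Off the diagonal the entry is linear in the conjugate of x_i, with j ≠ i, hence odd under the
  -- flip of x_i.
  · intro j _ hj
    refine integral_eq_zero_of_flip i fun x => ?_
    rw [hflip, Function.update_self, Function.update_of_ne hj, star_neg, neg_mul, neg_mul,
      Complex.neg_re, mul_neg]
  · simp

end Invariance

/-! ### The tangent inequality -/

/-- With T = X + A the right side is at least -log(1 - ‖u‖²/T), convex in (u, T) because ‖u‖²/T is.
The left side is its tangent at (u₀, X₀ + ‖u₀‖²). The proof uses log y ≤ y - 1 at the quotient of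
the two ratios; what is left is the square ‖u T₀ - u₀ T‖² ≥ 0 and the slack A - ‖u‖² ≥ 0. -/
theorem log_ratio_ge_tangent {X A X₀ : ℝ} {u u₀ : ℂ} (hX : 0 < X) (hu : ‖u‖ ^ 2 ≤ A)
    (hX₀ : 0 < X₀) :
    Real.log (1 + ‖u₀‖ ^ 2 / X₀) + 2 * (star u₀ * (u - u₀)).re / X₀ -
      ‖u₀‖ ^ 2 / ((X₀ + ‖u₀‖ ^ 2) * X₀) * ((X + A) - (X₀ + ‖u₀‖ ^ 2)) ≤
      Real.log ((X + A) / X) := by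
  have hA : 0 ≤ A := (sq_nonneg _).trans hu
  set q := ‖u₀‖ ^ 2 with hq
  have hq0 : 0 ≤ q := sq_nonneg _
  set T := X + A with hT
  set T₀ := X₀ + q with hT₀
  have hTpos : 0 < T := by positivity
  have hT₀pos : 0 < T₀ := by positivity
  have hlog : Real.log (X * T₀ / (T * X₀)) ≤ X * T₀ / (T * X₀) - 1 :=
    Real.log_le_sub_one_of_pos (by positivity)
  have e1 : Real.log (X * T₀ / (T * X₀)) = Real.log (1 + q / X₀) - Real.log (T / X) := by
    rw [← Real.log_div (by positivity) (by positivity)]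
    congr 1
    rw [hT₀]
    field_simp
  have hre : (star u₀ * (u - u₀)).re = (star u₀ * u).re - q := by
    rw [mul_sub, Complex.sub_re, hq, RCLike.star_def, Complex.conj_mul' u₀, ← Complex.ofReal_pow,
      Complex.ofReal_re]
  have hsq : 0 ≤ ‖u‖ ^ 2 * T₀ ^ 2 - 2 * (star u₀ * u).re * T * T₀ + q * T ^ 2 := by
    have h1 : ‖u * T₀ - u₀ * T‖ ^ 2 =
        ‖u‖ ^ 2 * T₀ ^ 2 - 2 * (star u₀ * u).re * T * T₀ + q * T ^ 2 := by
      rw [hq, ← Complex.normSq_eq_norm_sq, ← Complex.normSq_eq_norm_sq,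
        ← Complex.normSq_eq_norm_sq]
      simp [Complex.normSq_apply]
      ring
    rw [← h1]
    positivity
  have key : X * T₀ / (T * X₀) - 1 ≤
      -(2 * (star u₀ * (u - u₀)).re / X₀) + q / (T₀ * X₀) * (T - T₀) := by
    rw [← sub_nonneg]
    have e2 : -(2 * (star u₀ * (u - u₀)).re / X₀) + q / (T₀ * X₀) * (T - T₀) -
        (X * T₀ / (T * X₀) - 1) =
        ((A - ‖u‖ ^ 2) * T₀ ^ 2 +
          (‖u‖ ^ 2 * T₀ ^ 2 - 2 * (star u₀ * u).re * T * T₀ + q * T ^ 2)) / (T * T₀ * X₀) := by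
      rw [hre]
      have hX' : X = T - A := by rw [hT]; ring
      have hq' : q = T₀ - X₀ := by rw [hT₀]; ring
      rw [hX']
      field_simp
      rw [hq']
      ring
    rw [e2]
    have : 0 ≤ A - ‖u‖ ^ 2 := by linarith
    positivity
  linarith

/-! ### Bounds and integrability of the scalar term -/

section ScalarTerm

variable {n : ℕ} [NeZero n]

theorem eveTermScalar_nonneg {p : PowerAllocation} (hU : 0 ≤ p.PU) (h1 : 0 ≤ p.PV1)
    (h2 : 0 ≤ p.PV2) {G : Fin n → ℝ} (hG : ∀ i, 0 ≤ G i) : 0 ≤ eveTermScalar p G := by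
  have h0 := hG 0
  have hs : 0 ≤ ∑ i ∈ Finset.univ.erase (0 : Fin n), G i := Finset.sum_nonneg fun i _ => hG i
  refine Real.log_nonneg ?_
  rw [le_add_iff_nonneg_right]
  positivity

theorem eveTermScalar_le {p : PowerAllocation} (hU : 0 ≤ p.PU) (h1 : 0 ≤ p.PV1)
    (h2 : 0 ≤ p.PV2) {G : Fin n → ℝ} (hG : ∀ i, 0 ≤ G i) :
    eveTermScalar p G ≤ G 0 * p.PU := by
  have h0 := hG 0
  have hs : 0 ≤ ∑ i ∈ Finset.univ.erase (0 : Fin n), G i := Finset.sum_nonneg fun i _ => hG i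
  refine (Real.log_le_sub_one_of_pos (by positivity)).trans ?_
  rw [add_sub_cancel_left]
  refine div_le_self (by positivity) ?_
  have : 0 ≤ G 0 * p.PV1 := by positivity
  have : 0 ≤ (∑ i ∈ Finset.univ.erase (0 : Fin n), G i) * p.PV2 := by positivity
  linarith

theorem measurable_eveTermScalar (p : PowerAllocation) :
    Measurable (fun x : Fin n → ℂ => eveTermScalar p (fun i => ‖x i‖ ^ 2)) := by
  unfold eveTermScalar
  fun_prop

theorem integrable_eveTermScalar {p : PowerAllocation} (hU : 0 ≤ p.PU) (h1 : 0 ≤ p.PV1)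
    (h2 : 0 ≤ p.PV2) :
    Integrable (fun x : Fin n → ℂ => eveTermScalar p (fun i => ‖x i‖ ^ 2))
      (complexGaussianVec n) := by
  refine ((integrable_norm_sq_apply (0 : Fin n)).mul_const p.PU).mono'
    (measurable_eveTermScalar p).aestronglyMeasurable (Filter.Eventually.of_forall fun x => ?_)
  rw [Real.norm_of_nonneg (eveTermScalar_nonneg hU h1 h2 fun i => sq_nonneg _)]
  exact eveTermScalar_le hU h1 h2 fun i => sq_nonneg _

end ScalarTerm

theorem quadForm_diagonal {n : ℕ} (d : Fin n → ℝ) (x : Fin n → ℂ) :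
    quadForm (diagonal fun i => (d i : ℂ)) x = ∑ i, d i * ‖x i‖ ^ 2 := by
  simp only [quadForm, mulVec_diagonal, dotProduct, Complex.re_sum, Pi.star_apply, RCLike.star_def]
  refine Finset.sum_congr rfl fun i _ => ?_
  rw [mul_left_comm, Complex.conj_mul', ← Complex.ofReal_pow, Complex.re_ofReal_mul,
    Complex.ofReal_re]

theorem norm_update_neg {n : ℕ} (x : Fin n → ℂ) (i j : Fin n) :
    ‖Function.update x i (-x i) j‖ = ‖x j‖ := by
  by_cases hj : j = i
  · subst hj; simp
  · simp [hj]

theorem mulVec_update_neg {n : ℕ} (S : Matrix (Fin n) (Fin n) ℂ) (x : Fin n → ℂ) (i : Fin n) :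
    (S *ᵥ Function.update x i (-x i)) i = (S *ᵥ x) i - 2 * S i i * x i := by
  have h1 : Function.update x i (-x i) = x + Pi.single i (-2 * x i) := by
    funext j
    by_cases hj : j = i
    · subst hj; simp; ring
    · simp [hj]
  rw [h1, mulVec_add]
  simp
  ring

/-! ### Lower bound for the eavesdropper's expectation -/

section Comparison

variable {n : ℕ} [NeZero n]

/-- Replacing the signal by its beamforming component along the first axis and the noise by a
diagonal one, constant off the first axis, does not increase the eavesdropper's expectation. -/
theorem integral_eveTermScalar_le {Su Sv : Matrix (Fin n) (Fin n) ℂ} (hu : Su.PosSemidef)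
    (hv : Sv.PosSemidef) {b : ℝ} (hb : 0 ≤ b)
    (htr : ∑ i ∈ Finset.univ.erase (0 : Fin n), ((Su + Sv) i i).re ≤ ((n : ℝ) - 1) * b) :
    ∫ x, eveTermScalar ⟨(Su 0 0).re, (Sv 0 0).re, b⟩ (fun i => ‖x i‖ ^ 2) ∂complexGaussianVec n ≤
      ∫ x, eveTerm Su Sv x ∂complexGaussianVec n := by
  have hv0 : 0 ≤ (Sv 0 0).re := (Complex.nonneg_iff.1 hv.diag_nonneg).1
  have hu0 := Complex.nonneg_iff.1 (hu.diag_nonneg (i := 0))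
  set a := (Su 0 0).re with ha
  have haC : Su 0 0 = (a : ℂ) := Complex.ext (by simp [ha]) (by simp [← hu0.2])
  -- If a = 0 the scalar term vanishes identically. Otherwise division by √a is allowed below.
  rcases hu0.1.eq_or_lt with h0 | hapos
  · rw [← h0]
    have : ∀ x : Fin n → ℂ,
        eveTermScalar ⟨0, (Sv 0 0).re, b⟩ (fun i => ‖x i‖ ^ 2) = 0 := by
      intro x; simp [eveTermScalar]
    simp_rw [this, integral_zero]
    exact integral_nonneg fun x => eveTerm_nonneg hu hv x
  -- Tangent data of the candidate pair: `X₀` is its denominator, `X₀ + q₀` its numerator, `-k` the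
  -- slope in T, and `lin` the first-order term in u. `M` is the change of total covariance, with
  -- corner entry 0.
  let X₀ : (Fin n → ℂ) → ℝ := fun x =>
    1 + ‖x 0‖ ^ 2 * (Sv 0 0).re + (∑ i ∈ Finset.univ.erase (0 : Fin n), ‖x i‖ ^ 2) * b
  let q₀ : (Fin n → ℂ) → ℝ := fun x => ‖x 0‖ ^ 2 * a
  let k : (Fin n → ℂ) → ℝ := fun x => q₀ x / ((X₀ x + q₀ x) * X₀ x)
  let lin : (Fin n → ℂ) → ℝ := fun x => 2 * ((star (x 0) * (Su *ᵥ x) 0).re - q₀ x) / X₀ x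
  let d : Fin n → ℝ := fun i => if i = 0 then a + (Sv 0 0).re else b
  let M : Matrix (Fin n) (Fin n) ℂ := Su + Sv - diagonal fun i => (d i : ℂ)
  have hX₀ : ∀ x, 1 ≤ X₀ x := by
    intro x
    have h1 : 0 ≤ ‖x 0‖ ^ 2 * (Sv 0 0).re := by positivity
    have h2 : 0 ≤ (∑ i ∈ Finset.univ.erase (0 : Fin n), ‖x i‖ ^ 2) * b := by positivity
    simp only [X₀]
    linarith
  have hq₀ : ∀ x, 0 ≤ q₀ x := fun x => by simp only [q₀]; positivity
  have hX₀m : Measurable X₀ := by simp only [X₀]; fun_prop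
  have hq₀m : Measurable q₀ := by simp only [q₀]; fun_prop
  have hkm : Measurable k := hq₀m.div ((hX₀m.add hq₀m).mul hX₀m)
  have hk0 : ∀ x, 0 ≤ k x := fun x => by
    have := hX₀ x; have := hq₀ x
    simp only [k]; positivity
  have hk1 : ∀ x, k x ≤ 1 := fun x => by
    have := hX₀ x; have := hq₀ x
    simp only [k]
    refine div_le_one_of_le₀ ?_ (by positivity)
    nlinarith
  have hX₀flip : ∀ x i, X₀ (Function.update x i (-x i)) = X₀ x := fun x i => by
    simp only [X₀, norm_update_neg]
  have hq₀flip : ∀ x i, q₀ (Function.update x i (-x i)) = q₀ x := fun x i => by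
    simp only [q₀, norm_update_neg]
  have hkflip : ∀ x i, k (Function.update x i (-x i)) = k x := fun x i => by
    simp only [k, hX₀flip, hq₀flip]
  -- Subtracting `q₀` removes the j = 0 summand of the row; the remaining ones are linear in the
  -- conjugate of x_0 and free of x_0 otherwise.
  have hlinflip : ∀ x, lin (Function.update x 0 (-x 0)) = -lin x := fun x => by
    simp only [lin, hX₀flip, hq₀flip, mulVec_update_neg, Function.update_self, haC]
    have h1 : (star (-x 0) * ((Su *ᵥ x) 0 - 2 * (a : ℂ) * x 0)).re =
        -(star (x 0) * (Su *ᵥ x) 0).re + 2 * q₀ x := by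
      have h2 : star (-x 0) * ((Su *ᵥ x) 0 - 2 * (a : ℂ) * x 0) =
          -(star (x 0) * (Su *ᵥ x) 0) + ((2 * q₀ x : ℝ) : ℂ) := by
        simp only [q₀, star_neg, RCLike.star_def]
        push_cast
        rw [← Complex.conj_mul']
        ring
      rw [h2, Complex.add_re, Complex.ofReal_re, Complex.neg_re]
    rw [h1]
    ring
  have hlin0 : ∫ x, lin x ∂complexGaussianVec n = 0 := integral_eq_zero_of_flip 0 hlinflip
  have hlini : Integrable lin (complexGaussianVec n) := by
    have hw : Measurable fun x => (X₀ x)⁻¹ := hX₀m.inv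
    have hw0 : ∀ x, 0 ≤ (X₀ x)⁻¹ := fun x => inv_nonneg.2 (by linarith [hX₀ x])
    have hw1 : ∀ x, (X₀ x)⁻¹ ≤ 1 := fun x => inv_le_one_of_one_le₀ (hX₀ x)
    have h1 : Integrable (fun x => ∑ j, (X₀ x)⁻¹ * (star (x 0) * Su 0 j * x j).re)
        (complexGaussianVec n) :=
      integrable_finsetSum _ fun j _ => integrable_weighted_entry hw hw0 hw1 _ _ _
    have h2 := (h1.sub (integrable_weighted_entry hw hw0 hw1 (a : ℂ) 0 0)).const_mul 2
    refine h2.congr (Filter.Eventually.of_forall fun x => ?_)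
    have h3 : star (x 0) * (a : ℂ) * x 0 = ((q₀ x : ℝ) : ℂ) := by
      simp only [q₀, RCLike.star_def]
      push_cast
      rw [← Complex.conj_mul']
      ring
    simp only [Pi.sub_apply, h3, Complex.ofReal_re, lin, mulVec, dotProduct, Finset.mul_sum,
      Complex.re_sum, ← mul_assoc, div_eq_mul_inv, mul_sub, sub_mul, Finset.sum_mul]
    congr 1
    · exact Finset.sum_congr rfl fun j _ => by ring
    · ring
  have hM : ∀ x, quadForm M x = (1 + quadForm Sv x + quadForm Su x) - (X₀ x + q₀ x) := by
    intro x
    have h1 := quadForm_add M (diagonal fun i => (d i : ℂ)) x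
    rw [sub_add_cancel, quadForm_add, quadForm_diagonal,
      ← Finset.add_sum_erase _ _ (Finset.mem_univ (0 : Fin n))] at h1
    have h2 : ∑ i ∈ Finset.univ.erase (0 : Fin n), d i * ‖x i‖ ^ 2 =
        (∑ i ∈ Finset.univ.erase (0 : Fin n), ‖x i‖ ^ 2) * b := by
      rw [Finset.sum_mul]
      refine Finset.sum_congr rfl fun i hi => ?_
      simp only [d, if_neg (Finset.ne_of_mem_erase hi)]
      ring
    rw [h2] at h1
    simp only [d, if_true] at h1
    simp only [X₀, q₀]
    linarith
  -- The tangent inequality with u = (S_u x)_0 / √a and u₀ = √a x_0. The factors √a cancel in the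
  -- first-order term.
  have hpt : ∀ x, eveTermScalar ⟨a, (Sv 0 0).re, b⟩ (fun i => ‖x i‖ ^ 2) + lin x -
      k x * quadForm M x ≤ eveTerm Su Sv x := by
    intro x
    have hsa : (√a : ℂ) ≠ 0 := by
      exact_mod_cast (Real.sqrt_pos.2 hapos).ne'
    have hsa2 : (√a : ℂ) * √a = a := by
      exact_mod_cast Real.mul_self_sqrt hapos.le
    have hq : ‖(√a : ℂ) * x 0‖ ^ 2 = q₀ x := by
      simp only [q₀]
      rw [norm_mul, mul_pow, Complex.norm_real, Real.norm_eq_abs, sq_abs, Real.sq_sqrt hapos.le,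
        mul_comm]
    have hA : ‖(Su *ᵥ x) 0 / (√a : ℂ)‖ ^ 2 ≤ quadForm Su x := by
      rw [norm_div, div_pow, Complex.norm_real, Real.norm_eq_abs, sq_abs, Real.sq_sqrt hapos.le,
        div_le_iff₀ hapos, mul_comm]
      exact norm_mulVec_apply_sq_le hu 0 x
    have ht := log_ratio_ge_tangent (X := 1 + quadForm Sv x) (X₀ := X₀ x)
      (u₀ := (√a : ℂ) * x 0) (by linarith [quadForm_nonneg hv x]) hA (by linarith [hX₀ x])
    have hre : (star ((√a : ℂ) * x 0) * ((Su *ᵥ x) 0 / (√a : ℂ) - (√a : ℂ) * x 0)).re =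
        (star (x 0) * (Su *ᵥ x) 0).re - q₀ x := by
      have h2 : star ((√a : ℂ) * x 0) * ((Su *ᵥ x) 0 / (√a : ℂ) - (√a : ℂ) * x 0) =
          star (x 0) * (Su *ᵥ x) 0 - ((q₀ x : ℝ) : ℂ) := by
        simp only [q₀, star_mul', RCLike.star_def, Complex.conj_ofReal]
        push_cast
        rw [← Complex.conj_mul', ← hsa2]
        field_simp
      rw [h2, Complex.sub_re, Complex.ofReal_re]
    rw [hq, hre, ← hM] at ht
    have h3 : eveTerm Su Sv x =
        Real.log ((1 + quadForm Sv x + quadForm Su x) / (1 + quadForm Sv x)) := by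
      rw [eveTerm, quadForm_add, add_comm (quadForm Su x), ← add_assoc]
    rw [h3]
    exact ht
  -- Only the diagonal of `M` survives, its corner is 0, and all coordinates other than 0 carry the
  -- same weight by transposition; `htr` then gives the sign.
  have hksum : ∫ x, k x * quadForm M x ∂complexGaussianVec n ≤ 0 := by
    rw [integral_weighted_quadForm hkm hk0 hk1 hkflip,
      ← Finset.add_sum_erase _ _ (Finset.mem_univ (0 : Fin n))]
    have h0 : (M 0 0).re = 0 := by simp [M, d, ha]
    rw [h0, zero_mul, zero_add]
    rcases (Finset.univ.erase (0 : Fin n)).eq_empty_or_nonempty with he | ⟨j, hj⟩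
    · simp [he]
    have hperm : ∀ i ∈ Finset.univ.erase (0 : Fin n),
        ∫ x, k x * ‖x i‖ ^ 2 ∂complexGaussianVec n =
          ∫ x, k x * ‖x j‖ ^ 2 ∂complexGaussianVec n := by
      intro i hi
      rw [← integral_comp_perm (Equiv.swap i j)]
      refine integral_congr_ae (Filter.Eventually.of_forall fun x => ?_)
      have hs0 : Equiv.swap i j 0 = 0 :=
        Equiv.swap_apply_of_ne_of_ne (Finset.ne_of_mem_erase hi).symm
          (Finset.ne_of_mem_erase hj).symm
      have hsum : ∑ l ∈ Finset.univ.erase (0 : Fin n), ‖x (Equiv.swap i j l)‖ ^ 2 =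
          ∑ l ∈ Finset.univ.erase (0 : Fin n), ‖x l‖ ^ 2 := by
        refine Finset.sum_equiv (Equiv.swap i j) (fun l => ?_) (fun _ _ => rfl)
        simp only [Finset.mem_erase, Finset.mem_univ, and_true]
        rw [not_iff_not, ← hs0, (Equiv.swap i j).injective.eq_iff, hs0]
      simp only [k, X₀, q₀, Function.comp_apply, hs0, hsum, Equiv.swap_apply_left]
    rw [Finset.sum_congr rfl fun i hi => by rw [hperm i hi], ← Finset.sum_mul]
    refine mul_nonpos_of_nonpos_of_nonneg ?_
      (integral_nonneg fun x => mul_nonneg (hk0 x) (sq_nonneg _))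
    have h1 : ∑ i ∈ Finset.univ.erase (0 : Fin n), (M i i).re =
        ∑ i ∈ Finset.univ.erase (0 : Fin n), ((Su + Sv) i i).re - ((n : ℝ) - 1) * b := by
      have h2 : ((n : ℝ) - 1) * b = ∑ i ∈ Finset.univ.erase (0 : Fin n), b := by
        rw [Finset.sum_const, Finset.card_erase_of_mem (Finset.mem_univ _), Finset.card_univ,
          Fintype.card_fin, nsmul_eq_mul, Nat.cast_sub (NeZero.one_le), Nat.cast_one]
      rw [h2, ← Finset.sum_sub_distrib]
      refine Finset.sum_congr rfl fun i hi => ?_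
      simp [M, d, Finset.ne_of_mem_erase hi]
    rw [h1]
    linarith
  have hs := integrable_eveTermScalar (n := n) (p := ⟨a, (Sv 0 0).re, b⟩) hapos.le hv0 hb
  have hkq := integrable_weighted_quadForm hkm hk0 hk1 M
  have hle := integral_mono ((hs.add hlini).sub hkq) (integrable_eveTerm hu hv) hpt
  have he : ∫ x, (eveTermScalar ⟨a, (Sv 0 0).re, b⟩ (fun i => ‖x i‖ ^ 2) + lin x -
      k x * quadForm M x) ∂complexGaussianVec n =
      ∫ x, eveTermScalar ⟨a, (Sv 0 0).re, b⟩ (fun i => ‖x i‖ ^ 2) ∂complexGaussianVec n + 0 -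
        ∫ x, k x * quadForm M x ∂complexGaussianVec n := by
    rw [← hlin0, ← integral_add hs hlini]
    exact integral_sub (hs.add hlini) hkq
  have hle' := he.symm.le.trans hle
  linarith

end Comparison

/-! ### The scalar problem: monotonicity for one antenna, continuity, existence of a maximum -/

/-- As the gain `G` varies, the logarithmic increment from `b` to `c` is a concave function of the
logarithmic increment from `a` to `b`; this is its tangent line at the gain `H`. -/
theorem log_increment_le_tangent {a b c G H : ℝ} (ha : 0 ≤ a) (hab : a < b) (hbc : b ≤ c)
    (hG : 0 ≤ G) (hH : 0 ≤ H) :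
    Real.log ((1 + G * c) / (1 + G * b)) ≤ Real.log ((1 + H * c) / (1 + H * b)) +
      (c - b) * (1 + H * a) / ((b - a) * (1 + H * c)) *
        (Real.log ((1 + G * b) / (1 + G * a)) - Real.log ((1 + H * b) / (1 + H * a))) := by
  have hb : 0 < b := ha.trans_lt hab
  have hc : 0 < c := hb.trans_le hbc
  have hba : 0 < b - a := sub_pos.2 hab
  have hcb : 0 ≤ c - b := sub_nonneg.2 hbc
  set k := (c - b) * (1 + H * a) / ((b - a) * (1 + H * c)) with hk
  have hk0 : 0 ≤ k := by positivity
  have hpos : ∀ t : ℝ, 0 ≤ t → 0 < (1 + G * t) / (1 + H * t) := fun t ht => by positivity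
  -- Since b lies between a and c, the ratio (1 + G b)/(1 + H b) is a weighted mean of the ratios at
  -- c and a, the weights being in proportion 1 : k.
  have hconc := strictConcaveOn_log_Ioi.concaveOn.2 (Set.mem_Ioi.2 (hpos c hc.le))
    (Set.mem_Ioi.2 (hpos a ha)) (show (0 : ℝ) ≤ 1 / (1 + k) by positivity)
    (show (0 : ℝ) ≤ k / (1 + k) by positivity) (by field_simp)
  have hcomb : (1 / (1 + k)) • ((1 + G * c) / (1 + H * c)) +
      (k / (1 + k)) • ((1 + G * a) / (1 + H * a)) = (1 + G * b) / (1 + H * b) := by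
    have h1 : (1 + G * c) / (1 + H * c) + k * ((1 + G * a) / (1 + H * a)) =
        (1 + k) * ((1 + G * b) / (1 + H * b)) := by
      rw [hk]
      field_simp
      ring
    rw [smul_eq_mul, smul_eq_mul, div_mul_eq_mul_div, div_mul_eq_mul_div, one_mul, ← add_div, h1]
    field_simp
  rw [hcomb, smul_eq_mul, smul_eq_mul, div_mul_eq_mul_div, div_mul_eq_mul_div, one_mul, ← add_div,
    div_le_iff₀ (by positivity)] at hconc
  have hne : ∀ t : ℝ, 0 ≤ t → ∀ K : ℝ, 0 ≤ K → 1 + K * t ≠ 0 := fun t ht K hK => by positivity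
  rw [Real.log_div (hne c hc.le G hG) (hne c hc.le H hH),
    Real.log_div (hne a ha G hG) (hne a ha H hH),
    Real.log_div (hne b hb.le G hG) (hne b hb.le H hH)] at hconc
  rw [Real.log_div (hne c hc.le G hG) (hne b hb.le G hG),
    Real.log_div (hne c hc.le H hH) (hne b hb.le H hH),
    Real.log_div (hne b hb.le G hG) (hne a ha G hG),
    Real.log_div (hne b hb.le H hH) (hne a ha H hH)]
  linarith

theorem log_one_add_div {G u v : ℝ} (hG : 0 ≤ G) (hv : 0 ≤ v) :
    Real.log (1 + G * u / (1 + G * v)) = Real.log ((1 + G * (u + v)) / (1 + G * v)) := by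
  congr 1
  have : 0 < 1 + G * v := by positivity
  field_simp
  ring

section Scalar

variable {n : ℕ} [NeZero n]

theorem scalarRate_eq_of_hasLaw {Ω : Type*} [MeasurableSpace Ω] {μ : Measure Ω}
    {g : Ω → Fin n → ℂ} (hg : HasLaw g (complexGaussianVec n) μ) {G : Ω → Fin n → ℝ}
    (hG : ∀ ω i, G ω i = ‖g ω i‖ ^ 2) (h : EuclideanSpace ℂ (Fin n)) (p : PowerAllocation) :
    scalarRate μ G h p =
      scalarRate (complexGaussianVec n) (fun x i => ‖x i‖ ^ 2) h p := by
  have hG' : ∀ ω, G ω = fun i => ‖g ω i‖ ^ 2 := fun ω => funext (hG ω)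
  simp only [scalarRate, hG']
  rw [← hg.integral_comp (measurable_eveTermScalar p).aestronglyMeasurable]
  rfl

theorem eveTermScalar_of_erase_empty (he : Finset.univ.erase (0 : Fin n) = ∅) (u v w : ℝ)
    (G : Fin n → ℝ) : eveTermScalar ⟨u, v, w⟩ G = Real.log (1 + G 0 * u / (1 + G 0 * v)) := by
  simp [eveTermScalar, he]

/-- With a single antenna, spending the unused power on the signal does not decrease the rate. -/
theorem scalarRate_le_of_erase_empty (he : Finset.univ.erase (0 : Fin n) = ∅)
    (h : EuclideanSpace ℂ (Fin n)) {u u' v : ℝ} (w w' : ℝ) (hu : 0 ≤ u) (hv : 0 ≤ v)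
    (huu : u ≤ u') :
    scalarRate (complexGaussianVec n) (fun x i => ‖x i‖ ^ 2) h ⟨u, v, w⟩ ≤
      scalarRate (complexGaussianVec n) (fun x i => ‖x i‖ ^ 2) h ⟨u', v, w'⟩ := by
  simp only [scalarRate, eveTermScalar_of_erase_empty he]
  rcases hu.eq_or_lt with rfl | hu
  · simp
  have hi : ∀ s : ℝ, 0 ≤ s → Integrable
      (fun x : Fin n → ℂ => Real.log (1 + ‖x 0‖ ^ 2 * s / (1 + ‖x 0‖ ^ 2 * v)))
      (complexGaussianVec n) := by
    intro s hs
    have := integrable_eveTermScalar (n := n) (p := ⟨s, v, 0⟩) hs hv le_rfl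
    simpa only [eveTermScalar_of_erase_empty he] using this
  set H := ‖h‖ ^ 2 with hH
  have hH0 : 0 ≤ H := sq_nonneg _
  refine max_le (le_max_left _ _) ?_
  -- A nonpositive difference is clipped to 0, so only a positive one needs an argument.
  by_cases hpos : Real.log (1 + H * u / (1 + H * v)) -
      ∫ x : Fin n → ℂ, Real.log (1 + ‖x 0‖ ^ 2 * u / (1 + ‖x 0‖ ^ 2 * v)) ∂complexGaussianVec n ≤ 0
  · exact hpos.trans (le_max_left _ _)
  refine le_max_of_le_right ?_
  -- The slope in `log_increment_le_tangent` for the total powers v ≤ u + v ≤ u' + v, written so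
  -- that it matches literally.
  set k := (u' + v - (u + v)) * (1 + H * v) / ((u + v - v) * (1 + H * (u' + v))) with hk
  have hk0 : 0 ≤ k := by
    have h1 : 0 ≤ u' + v - (u + v) := by linarith
    have h2 : 0 ≤ u + v - v := by linarith
    have h3 : 0 ≤ u' := by linarith
    positivity
  have hsplit : ∀ K : ℝ, 0 ≤ K → Real.log (1 + K * u' / (1 + K * v)) =
      Real.log (1 + K * u / (1 + K * v)) +
        Real.log ((1 + K * (u' + v)) / (1 + K * (u + v))) := by
    intro K hK
    have h3 : 0 ≤ u' := by linarith
    rw [log_one_add_div hK hv, log_one_add_div hK hv,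
      ← Real.log_mul (by positivity) (by positivity)]
    congr 1
    field_simp
  set c := Real.log (1 + H * u / (1 + H * v)) with hc
  set d := Real.log ((1 + H * (u' + v)) / (1 + H * (u + v))) with hd
  have hmono := integral_mono (hi u' (by linarith))
    (((hi u hu.le).const_mul (1 + k)).add (integrable_const (d - k * c))) (fun x => by
      have ht := log_increment_le_tangent (a := v) (b := u + v) (c := u' + v) (G := ‖x 0‖ ^ 2)
        (H := H) hv (by linarith) (by linarith) (sq_nonneg _) hH0
      rw [← log_one_add_div (sq_nonneg _) hv, ← log_one_add_div hH0 hv, ← hk] at ht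
      simp only [Pi.add_apply]
      rw [hsplit _ (sq_nonneg _)]
      linarith)
  rw [integral_add' ((hi u hu.le).const_mul (1 + k)) (integrable_const _), integral_const_mul,
    integral_const, probReal_univ, one_smul] at hmono
  rw [hsplit H hH0]
  -- Integrating the tangent bound makes the new difference at least 1 + k times the old one, which
  -- is positive.
  have := mul_nonneg hk0 (not_le.1 hpos).le
  linarith

/-- Dominated convergence: on the box the eavesdropper's term is at most ‖x_0‖² P_T. -/
theorem continuousOn_scalarRate (h : EuclideanSpace ℂ (Fin n)) (PT : ℝ) :
    ContinuousOn (fun t : ℝ × ℝ × ℝ =>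
      scalarRate (complexGaussianVec n) (fun x i => ‖x i‖ ^ 2) h ⟨t.1, t.2.1, t.2.2⟩)
      (Set.Icc 0 PT ×ˢ Set.Icc 0 PT ×ˢ Set.Icc 0 PT) := by
  have hlog : ∀ A B : ℝ, 0 ≤ A → 0 ≤ B → ContinuousOn (fun t : ℝ × ℝ × ℝ =>
      Real.log (1 + A * t.1 / (1 + A * t.2.1 + B * t.2.2)))
      (Set.Icc 0 PT ×ˢ Set.Icc 0 PT ×ˢ Set.Icc 0 PT) := by
    intro A B hA hB
    have hd : ∀ t ∈ Set.Icc 0 PT ×ˢ Set.Icc 0 PT ×ˢ Set.Icc 0 PT,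
        0 < 1 + A * t.2.1 + B * t.2.2 := by
      rintro ⟨u, v, w⟩ ⟨-, hv, hw⟩
      have := hv.1
      have := hw.1
      simp only at *
      positivity
    refine ContinuousOn.log ?_ fun t ht => ?_
    · exact continuousOn_const.add ((by fun_prop : ContinuousOn _ _).div (by fun_prop)
        fun t ht => (hd t ht).ne')
    · have := hd t ht
      have := ht.1.1
      positivity
  unfold scalarRate
  refine continuousOn_const.sup (ContinuousOn.sub ?_ ?_)
  · simpa using hlog (‖h‖ ^ 2) 0 (sq_nonneg _) le_rfl
  · refine continuousOn_of_dominated (bound := fun x => ‖x 0‖ ^ 2 * PT)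
      (fun t _ => (measurable_eveTermScalar _).aestronglyMeasurable) (fun t ht => ?_)
      ((integrable_norm_sq_apply (0 : Fin n)).mul_const PT)
      (Filter.Eventually.of_forall fun x => ?_)
    · refine Filter.Eventually.of_forall fun x => ?_
      rw [Real.norm_of_nonneg
        (eveTermScalar_nonneg ht.1.1 ht.2.1.1 ht.2.2.1 fun i => sq_nonneg _)]
      refine (eveTermScalar_le ht.1.1 ht.2.1.1 ht.2.2.1 fun i => sq_nonneg _).trans ?_
      exact mul_le_mul_of_nonneg_left ht.1.2 (sq_nonneg _)
    · have := hlog (‖x 0‖ ^ 2) (∑ i ∈ Finset.univ.erase (0 : Fin n), ‖x i‖ ^ 2) (sq_nonneg _)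
        (Finset.sum_nonneg fun i _ => sq_nonneg _)
      simpa only [eveTermScalar, add_assoc] using this

theorem exists_isMaxOn_scalarRate (h : EuclideanSpace ℂ (Fin n)) {PT : ℝ} (hPT : 0 ≤ PT) :
    ∃ p ∈ admissiblePowers n PT, ∀ q ∈ admissiblePowers n PT,
      scalarRate (complexGaussianVec n) (fun x i => ‖x i‖ ^ 2) h q ≤
        scalarRate (complexGaussianVec n) (fun x i => ‖x i‖ ^ 2) h p := by
  -- For n = 1 the budget does not involve `PV2` and the feasible set is unbounded, so the
  -- compactness argument runs on its intersection with a box.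
  let K : Set (ℝ × ℝ × ℝ) := (Set.Icc 0 PT ×ˢ Set.Icc 0 PT ×ˢ Set.Icc 0 PT) ∩
    {t | t.1 + t.2.1 + ((n : ℝ) - 1) * t.2.2 = PT}
  have hK : IsCompact K :=
    (isCompact_Icc.prod (isCompact_Icc.prod isCompact_Icc)).inter_right
      (isClosed_eq (by fun_prop) continuous_const)
  have hne : K.Nonempty :=
    ⟨(PT, 0, 0), ⟨⟨⟨hPT, le_rfl⟩, ⟨le_rfl, hPT⟩, ⟨le_rfl, hPT⟩⟩, by simp⟩⟩
  obtain ⟨t, ht, hmax⟩ := hK.exists_isMaxOn hne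
    ((continuousOn_scalarRate h PT).mono Set.inter_subset_left)
  refine ⟨⟨t.1, t.2.1, t.2.2⟩, ⟨ht.1.1.1, ht.1.2.1.1, ht.1.2.2.1, ht.2⟩, ?_⟩
  rintro ⟨u, v, w⟩ ⟨hu, hv, hw, hsum⟩
  simp only at hu hv hw hsum
  have hn1 : (1 : ℝ) ≤ n := by exact_mod_cast NeZero.one_le
  rcases hn1.eq_or_lt with h1 | h1
  · have he : Finset.univ.erase (0 : Fin n) = ∅ := by
      rw [← Finset.card_eq_zero, Finset.card_erase_of_mem (Finset.mem_univ _), Finset.card_univ,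
        Fintype.card_fin]
      have : n = 1 := by exact_mod_cast h1.symm
      omega
    rw [← h1, sub_self, zero_mul, add_zero] at hsum
    -- With one antenna the rate ignores `PV2`, so it may be reset to 0 to enter the box.
    refine (scalarRate_le_of_erase_empty he h w 0 hu hv le_rfl).trans ?_
    exact hmax (a := (u, v, 0)) ⟨⟨⟨hu, by linarith⟩, ⟨hv, by linarith⟩, ⟨le_rfl, hPT⟩⟩,
      by simp [hsum]⟩
  · have h2 : (2 : ℝ) ≤ n := by
      have : 1 < n := by exact_mod_cast h1
      exact_mod_cast this
    have hw' : w ≤ ((n : ℝ) - 1) * w := by nlinarith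
    exact hmax (a := (u, v, w)) ⟨⟨⟨hu, by linarith⟩, ⟨hv, by linarith⟩, ⟨hw, by linarith⟩⟩, hsum⟩

end Scalar

/-! ### Reduction to a frame whose first axis is the main channel -/

theorem posSemidef_conj_diagonal {n : ℕ} (U : Matrix (Fin n) (Fin n) ℂ) {d : Fin n → ℝ}
    (hd : ∀ i, 0 ≤ d i) : (U * diagonal (fun i => (d i : ℂ)) * Uᴴ).PosSemidef :=
  (PosSemidef.diagonal fun i => by simpa using hd i).mul_mul_conjTranspose_same U

theorem eveTerm_mulVec {n : ℕ} (U Su Sv : Matrix (Fin n) (Fin n) ℂ) (x : Fin n → ℂ) :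
    eveTerm Su Sv (U *ᵥ x) = eveTerm (Uᴴ * Su * U) (Uᴴ * Sv * U) x := by
  rw [eveTerm, eveTerm, quadForm_mulVec, quadForm_mulVec, Matrix.mul_add, Matrix.add_mul]

theorem ganRate_zero {n : ℕ} {Ω : Type*} [MeasurableSpace Ω] {μ : Measure Ω}
    {g : Ω → Fin n → ℂ} {PT : ℝ}
    {S : Matrix (Fin n) (Fin n) ℂ × Matrix (Fin n) (Fin n) ℂ}
    (hS : S ∈ admissibleCov n PT) : ganRate μ g 0 S.1 S.2 = 0 := by
  have h0 : ∀ T : Matrix (Fin n) (Fin n) ℂ, quadForm T (0 : EuclideanSpace ℂ (Fin n)).ofLp = 0 :=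
    fun T => by simp [quadForm]
  have h1 : 0 ≤ ∫ ω, eveTerm S.1 S.2 (g ω) ∂μ :=
    integral_nonneg fun ω => eveTerm_nonneg hS.1 hS.2.1 _
  rw [ganRate, h0, h0]
  simpa using h1

section Frame

variable {n : ℕ} [NeZero n]

/-- The columns of `U` are an orthonormal basis extending the unit vector h/‖h‖. -/
theorem exists_unitary_mulVec_single {h : EuclideanSpace ℂ (Fin n)} (hh : h ≠ 0) :
    ∃ U : Matrix (Fin n) (Fin n) ℂ, Uᴴ * U = 1 ∧ U *ᵥ Pi.single 0 (‖h‖ : ℂ) = h.ofLp := by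
  have hn : (‖h‖ : ℂ) ≠ 0 := by exact_mod_cast (norm_pos_iff.2 hh).ne'
  have hunit : ‖(‖h‖ : ℂ)⁻¹ • h‖ = 1 := by
    rw [norm_smul, norm_inv, Complex.norm_real, norm_norm, inv_mul_cancel₀ (norm_ne_zero_iff.2 hh)]
  obtain ⟨b, hb⟩ := Orthonormal.exists_orthonormalBasis_extension_of_card_eq (𝕜 := ℂ)
    (ι := Fin n) (E := EuclideanSpace ℂ (Fin n)) (by simp) (v := fun _ => (‖h‖ : ℂ)⁻¹ • h)
    (s := {0}) (by
      rw [orthonormal_iff_ite]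
      rintro ⟨i, rfl⟩ ⟨j, rfl⟩
      simp [hunit, inner_self_eq_norm_sq_to_K])
  refine ⟨of fun i j => b j i, ?_, ?_⟩
  · ext i j
    have h1 := orthonormal_iff_ite.1 b.orthonormal i j
    rw [EuclideanSpace.inner_eq_star_dotProduct, dotProduct_comm] at h1
    rw [one_apply, ← h1]
    rfl
  · funext i
    simp [hb 0 rfl]
    field_simp

variable {h : EuclideanSpace ℂ (Fin n)} {U : Matrix (Fin n) (Fin n) ℂ}

theorem projLine_eq_conj (hh : h ≠ 0) (hUh : U *ᵥ Pi.single 0 (‖h‖ : ℂ) = h.ofLp) :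
    projLine h = U * diagonal (Pi.single 0 1) * Uᴴ := by
  have hn : (‖h‖ : ℂ) ≠ 0 := by exact_mod_cast (norm_pos_iff.2 hh).ne'
  have hcol : ∀ i, h.ofLp i = U i 0 * ‖h‖ := fun i => by rw [← hUh]; simp
  ext i j
  rw [projLine, Matrix.smul_apply, vecMulVec_apply, Pi.star_apply, hcol, hcol, Matrix.mul_apply,
    Finset.sum_eq_single 0]
  · simp
    field_simp
  · intro l _ hl
    simp [hl]
  · simp

theorem signalCov_eq_conj (hh : h ≠ 0) (hUh : U *ᵥ Pi.single 0 (‖h‖ : ℂ) = h.ofLp)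
    (p : PowerAllocation) :
    signalCov h p =
      U * diagonal (fun i => ((if i = 0 then p.PU else 0 : ℝ) : ℂ)) * Uᴴ := by
  rw [signalCov, projLine_eq_conj hh hUh, ← Matrix.smul_mul, ← Matrix.mul_smul, ← diagonal_smul]
  congr 3
  funext i
  by_cases hi : i = 0
  · subst hi; simp
  · simp [hi]

theorem noiseCov_eq_conj (hU : Uᴴ * U = 1) (hh : h ≠ 0)
    (hUh : U *ᵥ Pi.single 0 (‖h‖ : ℂ) = h.ofLp) (p : PowerAllocation) :
    noiseCov h p =
      U * diagonal (fun i => ((if i = 0 then p.PV1 else p.PV2 : ℝ) : ℂ)) * Uᴴ := by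
  have h1 : (1 : Matrix (Fin n) (Fin n) ℂ) = U * 1 * Uᴴ := by
    rw [mul_one, mul_eq_one_comm.1 hU]
  have h2 : ∀ (c : ℂ) (D : Matrix (Fin n) (Fin n) ℂ), c • (U * D * Uᴴ) = U * (c • D) * Uᴴ :=
    fun c D => by rw [Matrix.mul_smul, Matrix.smul_mul]
  rw [noiseCov, projLine_eq_conj hh hUh, h1, ← sub_mul, ← mul_sub, h2, h2, ← add_mul, ← mul_add,
    ← diagonal_one, diagonal_sub, ← diagonal_smul, ← diagonal_smul, diagonal_add]
  congr 3
  funext i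
  by_cases hi : i = 0
  · subst hi; simp
  · simp [hi]

theorem sum_ite_eq_zero (c d : ℝ) :
    ∑ i : Fin n, (if i = 0 then c else d) = c + ((n : ℝ) - 1) * d := by
  rw [← Finset.add_sum_erase _ _ (Finset.mem_univ (0 : Fin n)), if_pos rfl,
    Finset.sum_congr rfl fun i hi => if_neg (Finset.ne_of_mem_erase hi), Finset.sum_const,
    Finset.card_erase_of_mem (Finset.mem_univ _), Finset.card_univ,
    Fintype.card_fin, nsmul_eq_mul, Nat.cast_sub NeZero.one_le, Nat.cast_one]

theorem signalCov_noiseCov_mem (hh : h ≠ 0) {PT : ℝ} {p : PowerAllocation}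
    (hp : p ∈ admissiblePowers n PT) : (signalCov h p, noiseCov h p) ∈ admissibleCov n PT := by
  obtain ⟨U, hU, hUh⟩ := exists_unitary_mulVec_single hh
  obtain ⟨hu, hv1, hv2, hsum⟩ := hp
  rw [signalCov_eq_conj hh hUh, noiseCov_eq_conj hU hh hUh]
  refine ⟨posSemidef_conj_diagonal U fun i => ?_, posSemidef_conj_diagonal U fun i => ?_, ?_⟩
  · split_ifs <;> simp [hu]
  · split_ifs <;> assumption
  · rw [trace_add, trace_mul_comm, ← mul_assoc, hU, one_mul, trace_mul_comm, ← mul_assoc, hU,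
      one_mul, trace_diagonal, trace_diagonal, ← Complex.ofReal_sum, ← Complex.ofReal_sum,
      ← Complex.ofReal_add, Complex.ofReal_re, sum_ite_eq_zero, sum_ite_eq_zero]
    linarith

variable {Ω : Type*} [MeasurableSpace Ω] {μ : Measure Ω} {g : Ω → Fin n → ℂ}

/-- The rate in a unitary frame whose first axis is the main channel. -/
theorem ganRate_eq_conj (hg : HasLaw g (complexGaussianVec n) μ) (hU : Uᴴ * U = 1)
    (hUh : U *ᵥ Pi.single 0 (‖h‖ : ℂ) = h.ofLp) (Su Sv : Matrix (Fin n) (Fin n) ℂ) :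
    ganRate μ g h Su Sv =
      max 0 (Real.log ((1 + ‖h‖ ^ 2 * (((Uᴴ * Su * U) 0 0).re + ((Uᴴ * Sv * U) 0 0).re)) /
          (1 + ‖h‖ ^ 2 * ((Uᴴ * Sv * U) 0 0).re)) -
        ∫ x, eveTerm (Uᴴ * Su * U) (Uᴴ * Sv * U) x ∂complexGaussianVec n) := by
  have h1 : ∫ ω, eveTerm Su Sv (g ω) ∂μ =
      ∫ x, eveTerm (Uᴴ * Su * U) (Uᴴ * Sv * U) x ∂complexGaussianVec n := by
    simp_rw [← eveTerm_mulVec]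
    rw [integral_mulVec hU (eveTerm Su Sv)]
    exact hg.integral_comp (measurable_eveTerm Su Sv).aestronglyMeasurable
  rw [ganRate, h1, ← hUh, quadForm_add, quadForm_mulVec, quadForm_mulVec, quadForm_smul_single,
    quadForm_smul_single, mul_add]

theorem ganRate_signalCov_noiseCov (hg : HasLaw g (complexGaussianVec n) μ) (hh : h ≠ 0)
    {PT : ℝ} {p : PowerAllocation} (hp : p ∈ admissiblePowers n PT) :
    ganRate μ g h (signalCov h p) (noiseCov h p) =
      scalarRate (complexGaussianVec n) (fun x i => ‖x i‖ ^ 2) h p := by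
  obtain ⟨U, hU, hUh⟩ := exists_unitary_mulVec_single hh
  obtain ⟨hu, hv1, hv2, -⟩ := hp
  have hconj : ∀ D : Matrix (Fin n) (Fin n) ℂ, Uᴴ * (U * D * Uᴴ) * U = D := fun D => by
    rw [← mul_assoc, ← mul_assoc, hU, one_mul, mul_assoc, hU, mul_one]
  rw [ganRate_eq_conj hg hU hUh, signalCov_eq_conj hh hUh, noiseCov_eq_conj hU hh hUh, hconj, hconj]
  simp only [diagonal_apply_eq, Complex.ofReal_re, if_true, scalarRate]
  rw [log_one_add_div (sq_nonneg _) hv1]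
  congr 2
  refine integral_congr_ae (Filter.Eventually.of_forall fun x => ?_)
  have hs : 0 ≤ ∑ i ∈ Finset.univ.erase (0 : Fin n), ‖x i‖ ^ 2 :=
    Finset.sum_nonneg fun i _ => sq_nonneg _
  have hsum : ∀ c d : ℝ, ∑ i, (if i = 0 then c else d) * ‖x i‖ ^ 2 =
      ‖x 0‖ ^ 2 * c + (∑ i ∈ Finset.univ.erase (0 : Fin n), ‖x i‖ ^ 2) * d := by
    intro c d
    rw [← Finset.add_sum_erase _ _ (Finset.mem_univ (0 : Fin n)), if_pos rfl, mul_comm,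
      Finset.sum_mul]
    congr 1
    refine Finset.sum_congr rfl fun i hi => ?_
    rw [if_neg (Finset.ne_of_mem_erase hi), mul_comm]
  simp only [eveTerm, eveTermScalar, quadForm_add, quadForm_diagonal, hsum]
  congr 1
  have : 0 < 1 + ‖x 0‖ ^ 2 * p.PV1 +
      (∑ i ∈ Finset.univ.erase (0 : Fin n), ‖x i‖ ^ 2) * p.PV2 := by positivity
  rw [← add_assoc]
  field_simp
  ring

/-- In the rotated frame the corner entries are kept, so the main-channel term does not change,
while the eavesdropper's expectation can only drop by `integral_eveTermScalar_le`. -/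
theorem exists_ganRate_le_scalarRate (hg : HasLaw g (complexGaussianVec n) μ) (hh : h ≠ 0)
    {PT : ℝ} {Su Sv : Matrix (Fin n) (Fin n) ℂ} (hS : (Su, Sv) ∈ admissibleCov n PT) :
    ∃ p ∈ admissiblePowers n PT, ganRate μ g h Su Sv ≤
      scalarRate (complexGaussianVec n) (fun x i => ‖x i‖ ^ 2) h p := by
  obtain ⟨U, hU, hUh⟩ := exists_unitary_mulVec_single hh
  obtain ⟨hSu, hSv, htr⟩ := hS
  simp only at hSu hSv htr
  rw [ganRate_eq_conj hg hU hUh]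
  have hSu' := hSu.conjTranspose_mul_mul_same U
  have hSv' := hSv.conjTranspose_mul_mul_same U
  have htr' : (Uᴴ * Su * U + Uᴴ * Sv * U).trace.re ≤ PT := by
    rwa [← add_mul, ← mul_add, trace_mul_comm, ← mul_assoc, mul_eq_one_comm.1 hU, one_mul]
  set Tu := Uᴴ * Su * U
  set Tv := Uᴴ * Sv * U
  have hu0 : 0 ≤ (Tu 0 0).re := (Complex.nonneg_iff.1 hSu'.diag_nonneg).1
  have hv0 : 0 ≤ (Tv 0 0).re := (Complex.nonneg_iff.1 hSv'.diag_nonneg).1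
  set s := ∑ i ∈ Finset.univ.erase (0 : Fin n), ((Tu + Tv) i i).re with hs
  have hs0 : 0 ≤ s := Finset.sum_nonneg fun i _ =>
    (Complex.nonneg_iff.1 (hSu'.add hSv').diag_nonneg).1
  have hbudget : (Tu 0 0).re + (Tv 0 0).re + s ≤ PT := by
    rw [trace, Complex.re_sum, ← Finset.add_sum_erase _ _ (Finset.mem_univ (0 : Fin n))] at htr'
    simpa [hs] using htr'
  have hle : ∀ b : ℝ, 0 ≤ b → s ≤ ((n : ℝ) - 1) * b →
      max 0 (Real.log ((1 + ‖h‖ ^ 2 * ((Tu 0 0).re + (Tv 0 0).re)) /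
          (1 + ‖h‖ ^ 2 * (Tv 0 0).re)) - ∫ x, eveTerm Tu Tv x ∂complexGaussianVec n) ≤
        scalarRate (complexGaussianVec n) (fun x i => ‖x i‖ ^ 2) h
          ⟨(Tu 0 0).re, (Tv 0 0).re, b⟩ := by
    intro b hb hsb
    have := integral_eveTermScalar_le hSu' hSv' hb hsb
    rw [scalarRate, ← log_one_add_div (sq_nonneg _) hv0]
    exact max_le_max le_rfl (sub_le_sub_left this _)
  have hn1 : (1 : ℝ) ≤ n := by exact_mod_cast NeZero.one_le
  rcases hn1.eq_or_lt with h1 | h1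
  · have he : Finset.univ.erase (0 : Fin n) = ∅ := by
      rw [← Finset.card_eq_zero, Finset.card_erase_of_mem (Finset.mem_univ _), Finset.card_univ,
        Fintype.card_fin]
      have : n = 1 := by exact_mod_cast h1.symm
      omega
    have hs1 : s = 0 := by rw [hs, he, Finset.sum_empty]
    -- With one antenna all power not spent on noise is given to the signal.
    refine ⟨⟨PT - (Tv 0 0).re, (Tv 0 0).re, 0⟩, ⟨?_, hv0, le_rfl, by simp⟩, ?_⟩
    · simp only; linarith
    · exact (hle 0 le_rfl (by simp [hs1])).trans
        (scalarRate_le_of_erase_empty he h 0 0 hu0 hv0 (by linarith))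
  · have hpos : 0 < (n : ℝ) - 1 := sub_pos.2 h1
    have heq : ((n : ℝ) - 1) * ((PT - (Tu 0 0).re - (Tv 0 0).re) / ((n : ℝ) - 1)) =
        PT - (Tu 0 0).re - (Tv 0 0).re := mul_div_cancel₀ _ hpos.ne'
    have hb0 : 0 ≤ (PT - (Tu 0 0).re - (Tv 0 0).re) / ((n : ℝ) - 1) :=
      div_nonneg (by linarith) hpos.le
    -- Everything not used on the first axis is spread evenly over the n - 1 orthogonal directions;
    -- this meets the budget exactly and dominates the off-corner trace `s`.
    refine ⟨⟨(Tu 0 0).re, (Tv 0 0).re, (PT - (Tu 0 0).re - (Tv 0 0).re) / ((n : ℝ) - 1)⟩,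
      ⟨hu0, hv0, hb0, ?_⟩, hle _ hb0 ?_⟩
    · simp only; linarith
    · linarith

theorem scalarRate_zero {PT : ℝ} {p : PowerAllocation} (hp : p ∈ admissiblePowers n PT) :
    scalarRate (complexGaussianVec n) (fun x i => ‖x i‖ ^ 2) 0 p = 0 := by
  have h1 : 0 ≤ ∫ x : Fin n → ℂ, eveTermScalar p (fun i => ‖x i‖ ^ 2) ∂complexGaussianVec n :=
    integral_nonneg fun x => eveTermScalar_nonneg hp.1 hp.2.1 hp.2.2.1 fun i => sq_nonneg _
  simp [scalarRate, h1]

end Frame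

/-! ### Assembly -/

theorem theorem1 {n : ℕ} [NeZero n] {Ω : Type*} [MeasurableSpace Ω] (μ : Measure Ω)
    [IsProbabilityMeasure μ] (g : Ω → Fin n → ℂ) (hg : HasLaw g (complexGaussianVec n) μ)
    (h : EuclideanSpace ℂ (Fin n)) (PT : ℝ) (hPT : 0 ≤ PT)
    (G : Ω → Fin n → ℝ) (hG : ∀ ω i, G ω i = ‖g ω i‖ ^ 2) :
    -- the gains are i.i.d. exponential variables of mean one
    (∀ i, HasLaw (fun ω => G ω i) (expMeasure 1) μ) ∧
    iIndepFun (fun i ω => G ω i) μ ∧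
    -- all the expectations in the two problems are finite
    (∀ S ∈ admissibleCov n PT, Integrable (fun ω => eveTerm S.1 S.2 (g ω)) μ) ∧
    (∀ p ∈ admissiblePowers n PT, Integrable (fun ω => eveTermScalar p (G ω)) μ) ∧
    -- the three powers are those of the signal and of the noise along and orthogonal to `h`
    (h ≠ 0 → ∀ p ∈ admissiblePowers n PT,
      (signalCov h p, noiseCov h p) ∈ admissibleCov n PT ∧
      ganRate μ g h (signalCov h p) (noiseCov h p) = scalarRate μ G h p) ∧
    -- both maxima are attained, and they agree
    ∃ R : ℝ,
      IsGreatest ((fun S => ganRate μ g h S.1 S.2) '' admissibleCov n PT) R ∧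
      IsGreatest ((fun p => scalarRate μ G h p) '' admissiblePowers n PT) R := by
  have hG' : ∀ ω, G ω = fun i => ‖g ω i‖ ^ 2 := fun ω => funext (hG ω)
  have hint : ∀ {f : (Fin n → ℂ) → ℝ}, Integrable f (complexGaussianVec n) →
      Integrable (fun ω => f (g ω)) μ := by
    intro f hf
    rw [← hg.map_eq] at hf
    exact hf.comp_aemeasurable hg.aemeasurable
  have hrate := scalarRate_eq_of_hasLaw hg hG h
  refine ⟨fun i => ?_, ?_, fun S hS => hint (integrable_eveTerm hS.1 hS.2.1), fun p hp => ?_,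
    fun hh p hp => ⟨signalCov_noiseCov_mem hh hp, ?_⟩, ?_⟩
  · simp only [hG]
    exact (hasLaw_norm_sq_apply i).comp hg
  · simp only [hG]
    exact iIndepFun_norm_sq_of_hasLaw hg
  · simp only [hG']
    exact hint (integrable_eveTermScalar hp.1 hp.2.1 hp.2.2.1)
  · rw [hrate, ganRate_signalCov_noiseCov hg hh hp]
  · obtain ⟨p, hp, hmax⟩ := exists_isMaxOn_scalarRate h hPT
    refine ⟨scalarRate μ G h p, ⟨?_, ?_⟩, ⟨⟨p, hp, rfl⟩, ?_⟩⟩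
    -- For h = 0 there is no beamforming direction, but the main-channel term is 0 and the
    -- expectation nonnegative, so every admissible pair and triple has rate 0.
    · by_cases hh : h = 0
      · subst hh
        have hS : ((0, 0) : Matrix (Fin n) (Fin n) ℂ × Matrix (Fin n) (Fin n) ℂ) ∈
            admissibleCov n PT := ⟨PosSemidef.zero, PosSemidef.zero, by simpa using hPT⟩
        exact ⟨(0, 0), hS, by
          rw [hrate, scalarRate_zero hp]; exact ganRate_zero hS⟩
      · exact ⟨(signalCov h p, noiseCov h p), signalCov_noiseCov_mem hh hp, by
          rw [hrate]; exact ganRate_signalCov_noiseCov hg hh hp⟩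
    · rintro _ ⟨S, hS, rfl⟩
      by_cases hh : h = 0
      · subst hh
        simp only [hrate, scalarRate_zero hp, ganRate_zero hS, le_refl]
      · obtain ⟨q, hq, hle⟩ := exists_ganRate_le_scalarRate hg hh hS
        rw [hrate]
        exact hle.trans (hmax q hq)
    · rintro _ ⟨q, hq, rfl⟩
      simp only [hrate]
      exact hmax q hq
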